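/- Let $n\ge 1$ be an integer and let $\mathbf b=(b_1,\dots,b_n)$ be a vector of positive integers, with $(n,b_1)\neq(1,1)$. A $\mathbf b$-parking function is a list $(\beta_1,\dots,\beta_n)$ of positive integers whose nondecreasing rearrangement $\beta_1'\le\cdots\le\beta_n'$ satisfies $\beta_i'\le S_i := b_1+\cdots+b_i$ for $1\le i\le n$. Let $X_n(\mathbf b)\subset\mathbb R^n$ be the convex hull of all $\mathbf b$-parking functions, and for $0\le k\le n$ let $\mathbf y_k:=(1,\dots,1,S_{k+1},S_{k+2},\dots,S_n)\in\mathbb R^n$ (with $k$ leading ones). For $\pi\in\mathfrak S_n$ let $\pi(\sum_i a_i\mathbf e_i)=\sum_i a_i\mathbf e_{\pi(i)}$. Then: (a) $X_n(\mathbf b)$ is an $n$-dimensional simple polytope, i.e. each of its vertices is incident to exactly $n$ edges. (b) The set of vertices of $X_n(\mathbf b)$ is $\{\pi(\mathbf y_k) : \pi\in\mathfrak S_n,\ 0\le k\le n\}$. (c) $X_n(\mathbf b)$ is the set of points $(x_1,\dots,x_n)\in\mathbb R^n$ such that $x_i\ge 1$ for $1\le i\le n$ and $$\sum_{i\in I}x_i\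 \le\ \sum_{i=n-|I|+1}^{n}S_i$$ for all nonempty $I\subseteq\{1,\dots,n\}$ if $b_1\ge 2$, and for all nonempty $I\subseteq\{1,\dots,n\}$ with $|I|\ne n-1$ if $b_1=1$. The right-hand side equals $\sum_{j=1}^{n}\min\{j,|I|\}\,b_{n-j+1}$. This description is minimal: no proper subsystem of these inequalities describes $X_n(\mathbf b)$. Moreover these are precisely the facet-defining inequalities: for each of them the points of $X_n(\mathbf b)$ satisfying it with equality form a facet, and every facet of $X_n(\mathbf b)$ arises in this way from exactly one of them. -/

import Mathlib

namespace ParkingPolytope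

noncomputable section

/-! Faces of convex sets in coordinate space. -/

/-- The affine dimension of a (nonempty) set `F` of points. -/
def dim {n : ℕ} (F : Set (Fin n → ℝ)) : ℕ :=
  Module.finrank ℝ (vectorSpan ℝ F)

/-- A polytope: the convex hull of a finite set of points. -/
def IsPolytope {n : ℕ} (P : Set (Fin n → ℝ)) : Prop :=
  ∃ s : Set (Fin n → ℝ), s.Finite ∧ P = convexHull ℝ s

/-- A nonempty face of `P`: the set of points of `P` at which some linear functional attains
its maximum over `P` (the zero functional yields `P` itself). -/
def IsFace {n : ℕ} (P F : Set (Fin n → ℝ)) : Prop :=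
  F.Nonempty ∧ IsExposed ℝ P F

/-- The vertices of `P` are its extreme points. -/
def vertices {n : ℕ} (P : Set (Fin n → ℝ)) : Set (Fin n → ℝ) :=
  P.extremePoints ℝ

/-- An edge: a face of dimension one. -/
def IsEdge {n : ℕ} (P F : Set (Fin n → ℝ)) : Prop :=
  IsFace P F ∧ dim F = 1

/-- A facet: a face of codimension one. -/
def IsFacet {n : ℕ} (P F : Set (Fin n → ℝ)) : Prop :=
  IsFace P F ∧ dim F + 1 = dim P

/-- A simple polytope: the number of edges incident to each vertex is the dimension. -/
def IsSimplePolytope {n : ℕ} (P : Set (Fin n → ℝ)) : Prop :=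
  IsPolytope P ∧ ∀ v ∈ vertices P, {F | IsEdge P F ∧ v ∈ F}.encard = (dim P : ℕ∞)

/-! Systems of linear inequalities. -/

/-- The linear inequality `normal ⬝ x ≤ bound` in the unknown `x`. -/
@[ext]
structure LinIneq (n : ℕ) where
  normal : Fin n → ℝ
  bound : ℝ

/-- The point `x` satisfies the inequality `q`. -/
def LinIneq.Holds {n : ℕ} (q : LinIneq n) (x : Fin n → ℝ) : Prop :=
  ∑ i, q.normal i * x i ≤ q.bound

/-- The point `x` satisfies the inequality `q` with equality. -/
def LinIneq.Tight {n : ℕ} (q : LinIneq n) (x : Fin n → ℝ) : Prop :=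
  ∑ i, q.normal i * x i = q.bound

/-- The set of points satisfying every inequality in `Q`. -/
def solutionSet {n : ℕ} (Q : Set (LinIneq n)) : Set (Fin n → ℝ) :=
  {x | ∀ q ∈ Q, q.Holds x}

/-- `Q` describes `P`, and no proper subsystem of `Q` does. -/
def IsMinimalDescription {n : ℕ} (Q : Set (LinIneq n)) (P : Set (Fin n → ℝ)) : Prop :=
  solutionSet Q = P ∧ ∀ R : Set (LinIneq n), R ⊂ Q → solutionSet R ≠ P

/-! Parking functions. Coordinates are indexed from `0`, so that `b i` is the entry `b_{i+1}`. -/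

/-- The partial sums: `S b i` is `S_{i+1} = b_1 + ⋯ + b_{i+1}`. -/
def S {n : ℕ} (b : Fin n → ℕ) (i : Fin n) : ℕ :=
  ∑ j ∈ Finset.Iic i, b j

/-- A list `β` of positive integers whose nondecreasing rearrangement `β ∘ σ` is bounded
termwise by the partial sums of `b`. -/
def IsParkingFunction {n : ℕ} (b β : Fin n → ℕ) : Prop :=
  (∀ i, 0 < β i) ∧ ∃ σ : Equiv.Perm (Fin n), Monotone (β ∘ σ) ∧ ∀ i, β (σ i) ≤ S b i

/-- The parking-function polytope of `b`. -/
def X {n : ℕ} (b : Fin n → ℕ) : Set (Fin n → ℝ) :=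
  convexHull ℝ {x | ∃ β : Fin n → ℕ, IsParkingFunction b β ∧ x = fun i => (β i : ℝ)}

/-- The point `y_k = (1, …, 1, S_{k+1}, …, S_n)`, with `k` leading ones. -/
def y {n : ℕ} (b : Fin n → ℕ) (k : ℕ) : Fin n → ℝ :=
  fun i => if (i : ℕ) < k then 1 else (S b i : ℝ)

/-- The linear action of the symmetric group: `π` sends the basis vector `e_i` to `e_{π i}`. -/
def permute {n : ℕ} (π : Equiv.Perm (Fin n)) (x : Fin n → ℝ) : Fin n → ℝ :=
  fun i => x (π.symm i)

/-- The sum `S_{n-m+1} + ⋯ + S_n` of the last `m` partial sums. -/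
def topSum {n : ℕ} (b : Fin n → ℕ) (m : ℕ) : ℕ :=
  ∑ i ∈ (Finset.univ : Finset (Fin n)).filter (fun i => n ≤ i.val + m), S b i

/-- The inequality `x_i ≥ 1`, written as `-x_i ≤ -1`. -/
def lowerIneq {n : ℕ} (i : Fin n) : LinIneq n where
  normal := fun j => if j = i then -1 else 0
  bound := -1

/-- The inequality `∑_{i ∈ I} x_i ≤ S_{n-|I|+1} + ⋯ + S_n`. -/
def upperIneq {n : ℕ} (b : Fin n → ℕ) (I : Finset (Fin n)) : LinIneq n where
  normal := fun j => if j ∈ I then 1 else 0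
  bound := (topSum b I.card : ℝ)

/-- The inequalities `x_i ≥ 1` for all `i`, and those given by the nonempty sets `I`, where the
sets with `|I| = n - 1` are left out if `b_1 = 1`. -/
def parkingSystem {n : ℕ} [NeZero n] (b : Fin n → ℕ) : Set (LinIneq n) :=
  {q | ∃ i : Fin n, q = lowerIneq i} ∪
  {q | ∃ I : Finset (Fin n), I.Nonempty ∧ (b 0 = 1 → I.card ≠ n - 1) ∧ q = upperIneq b I}

end

end ParkingPolytope

/-!
The inequalities of the parking system are satisfied by all parking functions. Conversely, every
linear functional on the solution set attains its maximum at one of the points `π(y_k)`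
(`exists_candidate_ge`): sort its coefficients, let `k` of them be nonpositive, and sum by parts;
the coordinates with nonpositive coefficients are bounded below by `1`, and the tail sums of the
others are bounded above by the inequalities for the sets of largest coefficients. By separation the
solution set is the convex hull of the points `π(y_k)`, which are parking functions themselves, so
it is the polytope (`X_eq_solutionSet`).

Since the partial sums are strictly increasing, exactly `n` inequalities of the system are tight at
`π(y_k)`, and their normals are linearly independent (`exists_isSimpleVertex`). For `S_1 = 1` the
points `y_0` and `y_1` coincide, and the count is right because the inequalities with `|I| = n - 1`
are absent.

The rest holds for the solution set of any finite system at such a simple vertex `v`. Near `v` it is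
a simplicial cone: the basis dual to the tight normals gives the directions of the edges, and the
faces containing `v` are the sets on which a subset of the `n` tight inequalities holds with
equality (`IsSimpleVertex.exists_tightFace`), with each inequality lowering the dimension by one
(`IsSimpleVertex.dim_tightFace`). So there are `n` edges at `v`, and the facets through `v`
correspond to the inequalities tight at `v`, none of which can be dropped. Every inequality is tight
at some `π(y_k)`, and every facet contains some `π(y_k)`, again because functionals are maximal
there.
-/

namespace ParkingPolytope

/-! ### Simple vertices of a system of inequalities -/

/-- The point `v` solves the system `Q`, exactly the `n` inequalities `t i` of `Q` are tight at
`v`, and their normals are linearly independent: independence is expressed by saying that only the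
zero vector is orthogonal to all of them. -/
structure IsSimpleVertex {n : ℕ} (Q : Set (LinIneq n)) (v : Fin n → ℝ) (t : Fin n → LinIneq n) :
    Prop where
  holds : v ∈ solutionSet Q
  tight_iff : ∀ q ∈ Q, q.Tight v ↔ q ∈ Set.range t
  mem : ∀ i, t i ∈ Q
  eq_zero : ∀ x : Fin n → ℝ, (∀ i, (t i).normal ⬝ᵥ x = 0) → x = 0

/-- The face of the solution set of `Q` on which the inequalities `t i`, `i ∈ A`, are tight. -/
def tightFace {n : ℕ} (Q : Set (LinIneq n)) (t : Fin n → LinIneq n) (A : Finset (Fin n)) :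
    Set (Fin n → ℝ) :=
  {x ∈ solutionSet Q | ∀ i ∈ A, (t i).Tight x}

theorem LinIneq.holds_iff {n : ℕ} {q : LinIneq n} {x : Fin n → ℝ} :
    q.Holds x ↔ q.normal ⬝ᵥ x ≤ q.bound := Iff.rfl

theorem LinIneq.tight_iff {n : ℕ} {q : LinIneq n} {x : Fin n → ℝ} :
    q.Tight x ↔ q.normal ⬝ᵥ x = q.bound := Iff.rfl

namespace IsSimpleVertex

variable {n : ℕ} {Q : Set (LinIneq n)} {v : Fin n → ℝ} {t : Fin n → LinIneq n}

theorem tight (h : IsSimpleVertex Q v t) (i : Fin n) : (t i).normal ⬝ᵥ v = (t i).bound :=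
  (h.tight_iff _ (h.mem i)).2 ⟨i, rfl⟩

/-- The direction `d j` keeps all tight inequalities other than `t j` tight and moves into the
half-space of `t j`; for `A = univ \ {j}` the edge `tightFace Q t A` points along `d j`. -/
theorem exists_directions (h : IsSimpleVertex Q v t) :
    ∃ d : Fin n → Fin n → ℝ, ∀ i j, (t i).normal ⬝ᵥ d j = if i = j then -1 else 0 := by
  let M : Matrix (Fin n) (Fin n) ℝ := fun i => (t i).normal
  have hinj : Function.Injective M.mulVecLin := by
    rw [← LinearMap.ker_eq_bot, LinearMap.ker_eq_bot']
    intro x hx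
    exact h.eq_zero x fun i => congrFun hx i
  have hsurj := LinearMap.injective_iff_surjective.1 hinj
  choose g hg using hsurj
  refine ⟨fun j => g fun i => if i = j then -1 else 0, fun i j => ?_⟩
  exact congrFun (hg fun i => if i = j then -1 else 0) i

/-- The directions form a basis, in which the coordinates are the negated values of the tight
normals. -/
theorem eq_sum_directions (h : IsSimpleVertex Q v t) {d : Fin n → Fin n → ℝ}
    (hd : ∀ i j, (t i).normal ⬝ᵥ d j = if i = j then -1 else 0) (x : Fin n → ℝ) :
    x = ∑ j, (-((t j).normal ⬝ᵥ x)) • d j := by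
  rw [← sub_eq_zero]
  apply h.eq_zero
  intro i
  simp [dotProduct_sum, dotProduct_smul, hd]

/-- For small `ε` the moves from `v` along `± d j` keep the inequalities that are not tight at `v`,
so that only `t j` can be violated, and only in the direction `- d j`. -/
theorem exists_pos_mem (h : IsSimpleVertex Q v t) (hQ : Q.Finite) {d : Fin n → Fin n → ℝ}
    (hd : ∀ i j, (t i).normal ⬝ᵥ d j = if i = j then -1 else 0) :
    ∃ ε : ℝ, 0 < ε ∧ ∀ j, v + ε • d j ∈ solutionSet Q ∧
      ∀ q ∈ Q, q ≠ t j → q.Holds (v - ε • d j) := by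
  have key : ∀ᶠ s in nhdsWithin (0 : ℝ) (Set.Ioi 0), ∀ j, ∀ q ∈ Q, q ∉ Set.range t →
      q.normal ⬝ᵥ (v + s • d j) ≤ q.bound ∧ q.normal ⬝ᵥ (v - s • d j) ≤ q.bound := by
    rw [Filter.eventually_all]
    intro j
    rw [Filter.eventually_all_finite hQ]
    intro q hq
    by_cases hqt : q ∈ Set.range t
    · simp [hqt]
    have hlt : q.normal ⬝ᵥ v < q.bound :=
      lt_of_le_of_ne (h.holds q hq) fun e => hqt ((h.tight_iff q hq).1 e)
    have h1 : Filter.Tendsto (fun s : ℝ => q.normal ⬝ᵥ v + s * (q.normal ⬝ᵥ d j))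
        (nhdsWithin 0 (Set.Ioi 0)) (nhds (q.normal ⬝ᵥ v)) := by
      apply tendsto_nhdsWithin_of_tendsto_nhds
      have : Continuous fun s : ℝ => q.normal ⬝ᵥ v + s * (q.normal ⬝ᵥ d j) := by fun_prop
      simpa using this.tendsto 0
    have h2 : Filter.Tendsto (fun s : ℝ => q.normal ⬝ᵥ v - s * (q.normal ⬝ᵥ d j))
        (nhdsWithin 0 (Set.Ioi 0)) (nhds (q.normal ⬝ᵥ v)) := by
      apply tendsto_nhdsWithin_of_tendsto_nhds
      have : Continuous fun s : ℝ => q.normal ⬝ᵥ v - s * (q.normal ⬝ᵥ d j) := by fun_prop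
      simpa using this.tendsto 0
    filter_upwards [h1.eventually_lt_const hlt, h2.eventually_lt_const hlt] with s hs hs' _
    simp only [dotProduct_add, dotProduct_sub, dotProduct_smul, smul_eq_mul]
    exact ⟨hs.le, hs'.le⟩
  obtain ⟨ε, hε, hpos⟩ := (key.and self_mem_nhdsWithin).exists
  refine ⟨ε, hpos, fun j => ⟨fun q hq => ?_, fun q hq hqj => ?_⟩⟩
  · by_cases hqt : q ∈ Set.range t
    · obtain ⟨i, rfl⟩ := hqt
      rw [LinIneq.holds_iff, dotProduct_add, dotProduct_smul, hd, h.tight, smul_eq_mul]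
      have : 0 < ε := hpos
      split_ifs <;> linarith
    · exact (hε j q hq hqt).1
  · by_cases hqt : q ∈ Set.range t
    · obtain ⟨i, rfl⟩ := hqt
      have : i ≠ j := fun e => hqj (e ▸ rfl)
      simp [LinIneq.holds_iff, dotProduct_sub, dotProduct_smul, hd, h.tight, this]
    · exact (hε j q hq hqt).2

theorem mem_tightFace (h : IsSimpleVertex Q v t) (A : Finset (Fin n)) : v ∈ tightFace Q t A :=
  ⟨h.holds, fun i _ => h.tight i⟩

theorem add_smul_mem_tightFace_iff (h : IsSimpleVertex Q v t) {d : Fin n → Fin n → ℝ}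
    (hd : ∀ i j, (t i).normal ⬝ᵥ d j = if i = j then -1 else 0) {ε : ℝ} (hε : 0 < ε) {j : Fin n}
    (hmem : v + ε • d j ∈ solutionSet Q) (A : Finset (Fin n)) :
    v + ε • d j ∈ tightFace Q t A ↔ j ∉ A := by
  constructor
  · intro hx hj
    have := hx.2 j hj
    rw [LinIneq.tight_iff, dotProduct_add, dotProduct_smul, hd, h.tight] at this
    simp at this
    exact hε.ne' this
  · refine fun hj => ⟨hmem, fun i hi => ?_⟩
    have : i ≠ j := fun e => hj (e ▸ hi)
    simp [LinIneq.tight_iff, dotProduct_add, dotProduct_smul, hd, h.tight, this]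

theorem tightFace_injective (h : IsSimpleVertex Q v t) (hQ : Q.Finite) :
    Function.Injective (tightFace Q t) := by
  obtain ⟨d, hd⟩ := h.exists_directions
  obtain ⟨ε, hε, hmem⟩ := h.exists_pos_mem hQ hd
  intro A B hAB
  ext j
  rw [← not_iff_not, ← h.add_smul_mem_tightFace_iff hd hε (hmem j).1, hAB,
    h.add_smul_mem_tightFace_iff hd hε (hmem j).1]

/-- The direction space of the face is spanned by the `d j` with `j ∉ A`. -/
theorem dim_tightFace (h : IsSimpleVertex Q v t) (hQ : Q.Finite) (A : Finset (Fin n)) :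
    dim (tightFace Q t A) + A.card = n := by
  obtain ⟨d, hd⟩ := h.exists_directions
  obtain ⟨ε, hε, hmem⟩ := h.exists_pos_mem hQ hd
  have hli : LinearIndependent ℝ d := by
    rw [Fintype.linearIndependent_iff]
    intro g hg i
    have := congrArg (fun x => (t i).normal ⬝ᵥ x) hg
    simpa [dotProduct_sum, dotProduct_smul, hd] using this
  have hspan : vectorSpan ℝ (tightFace Q t A) =
      Submodule.span ℝ (Set.range fun j : {j // j ∉ A} => d j) := by
    apply le_antisymm
    · rw [vectorSpan_def, Submodule.span_le]
      rintro _ ⟨x, hx, y, hy, rfl⟩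
      simp only [vsub_eq_sub]
      rw [h.eq_sum_directions hd (x - y)]
      refine Submodule.sum_mem _ fun j _ => ?_
      by_cases hj : j ∈ A
      · have h1 := hx.2 j hj
        have h2 := hy.2 j hj
        rw [LinIneq.tight_iff] at h1 h2
        simp [dotProduct_sub, h1, h2]
      · exact Submodule.smul_mem _ _ (Submodule.subset_span ⟨⟨j, hj⟩, rfl⟩)
    · rw [Submodule.span_le]
      rintro _ ⟨⟨j, hj⟩, rfl⟩
      have h1 := vsub_mem_vectorSpan ℝ
        ((h.add_smul_mem_tightFace_iff hd hε (hmem j).1 A).2 hj) (h.mem_tightFace A)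
      simp only [vsub_eq_sub, add_sub_cancel_left] at h1
      exact (Submodule.smul_mem_iff _ hε.ne').1 h1
  rw [dim, hspan, finrank_span_eq_card (b := fun j : {j // j ∉ A} => d j)
    (hli.comp _ Subtype.val_injective)]
  have := Fintype.card_subtype_compl (fun j => j ∈ A)
  simp only [Fintype.card_fin, Fintype.card_coe] at this
  have h2 := Finset.card_le_univ A
  simp only [Fintype.card_fin] at h2
  omega

/-- A functional that is maximal at a simple vertex is a nonnegative combination of the tight
normals, and is therefore maximal exactly where those with a positive coefficient are tight. -/
theorem exists_tightFace (h : IsSimpleVertex Q v t) (hQ : Q.Finite) {F : Set (Fin n → ℝ)}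
    (hF : IsFace (solutionSet Q) F) (hv : v ∈ F) : ∃ A, F = tightFace Q t A := by
  classical
  obtain ⟨d, hd⟩ := h.exists_directions
  obtain ⟨ε, hε, hmem⟩ := h.exists_pos_mem hQ hd
  obtain ⟨l, rfl⟩ := hF.2 hF.1
  have hneg : ∀ j, l (d j) ≤ 0 := by
    intro j
    have := hv.2 _ (hmem j).1
    simp only [map_add, map_smul, smul_eq_mul] at this
    by_contra hpos
    have := mul_pos hε (not_le.1 hpos)
    linarith
  have hl : ∀ x, l x = l v + ∑ j, ((t j).bound - (t j).normal ⬝ᵥ x) * l (d j) := by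
    intro x
    have h1 := congrArg l (h.eq_sum_directions hd (x - v))
    simp only [map_sub, map_sum, map_smul, smul_eq_mul, dotProduct_sub, h.tight, neg_sub] at h1
    linarith
  refine ⟨Finset.univ.filter fun j => l (d j) ≠ 0, ?_⟩
  ext x
  constructor
  · rintro ⟨hx, hmax⟩
    refine ⟨hx, fun j hj => ?_⟩
    have hterm : ∀ j ∈ Finset.univ, ((t j).bound - (t j).normal ⬝ᵥ x) * l (d j) ≤ 0 := fun j _ =>
      mul_nonpos_of_nonneg_of_nonpos (sub_nonneg.2 (hx _ (h.mem j))) (hneg j)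
    have h0 : ∑ j, ((t j).bound - (t j).normal ⬝ᵥ x) * l (d j) = 0 := by
      apply le_antisymm
      · exact Finset.sum_nonpos hterm
      · have := hmax v h.holds
        rw [hl x] at this
        linarith
    rw [Finset.sum_eq_zero_iff_of_nonpos hterm] at h0
    have := (mul_eq_zero.1 (h0 j (Finset.mem_univ j))).resolve_right (Finset.mem_filter.1 hj).2
    rw [LinIneq.tight_iff]
    linarith
  · rintro ⟨hx, htight⟩
    refine ⟨hx, fun y hy => (hv.2 y hy).trans_eq ?_⟩
    rw [hl x, Finset.sum_eq_zero, add_zero]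
    intro j _
    by_cases hj : l (d j) = 0
    · rw [hj, mul_zero]
    · have := htight j (Finset.mem_filter.2 ⟨Finset.mem_univ j, hj⟩)
      rw [LinIneq.tight_iff] at this
      rw [this, sub_self, zero_mul]

/-- The sum of the normals of the inequalities `t i`, `i ∈ A`, exposes `tightFace Q t A`. -/
theorem isFace_tightFace (h : IsSimpleVertex Q v t) (A : Finset (Fin n)) :
    IsFace (solutionSet Q) (tightFace Q t A) := by
  refine ⟨⟨v, h.mem_tightFace A⟩, fun _ => ?_⟩
  let l : (Fin n → ℝ) →ₗ[ℝ] ℝ := ∑ i ∈ A, dotProductBilin ℝ ℝ (t i).normal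
  have hl : ∀ x, l x = ∑ i ∈ A, (t i).normal ⬝ᵥ x := by
    intro x
    simp [l, LinearMap.sum_apply]
  refine ⟨LinearMap.toContinuousLinearMap l, ?_⟩
  have hle : ∀ x ∈ solutionSet Q, l x ≤ ∑ i ∈ A, (t i).bound := fun x hx => by
    rw [hl]
    exact Finset.sum_le_sum fun i _ => hx _ (h.mem i)
  have hv : l v = ∑ i ∈ A, (t i).bound := by
    rw [hl]
    exact Finset.sum_congr rfl fun i _ => h.tight i
  ext x
  constructor
  · rintro ⟨hx, htight⟩
    refine ⟨hx, fun y hy => ?_⟩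
    have : l x = ∑ i ∈ A, (t i).bound := by
      rw [hl]
      exact Finset.sum_congr rfl fun i hi => htight i hi
    simpa [this] using hle y hy
  · rintro ⟨hx, hmax⟩
    refine ⟨hx, ?_⟩
    have h1 : ∑ i ∈ A, (t i).normal ⬝ᵥ x = ∑ i ∈ A, (t i).bound := by
      apply le_antisymm
      · rw [← hl]
        exact hle x hx
      · rw [← hl, ← hv]
        exact hmax v h.holds
    exact (Finset.sum_eq_sum_iff_of_le fun i _ => hx _ (h.mem i)).1 h1

theorem mem_vertices (h : IsSimpleVertex Q v t) : v ∈ vertices (solutionSet Q) := by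
  have hF : tightFace Q t Finset.univ = {v} := by
    ext x
    constructor
    · rintro ⟨_, hx⟩
      rw [Set.mem_singleton_iff, ← sub_eq_zero]
      refine h.eq_zero _ fun i => ?_
      have := hx i (Finset.mem_univ i)
      rw [LinIneq.tight_iff] at this
      rw [dotProduct_sub, this, h.tight, sub_self]
    · rintro rfl
      exact h.mem_tightFace _
  have := (h.isFace_tightFace Finset.univ).2.isExtreme
  rw [hF] at this
  exact isExtreme_singleton.1 this

theorem dim_solutionSet (h : IsSimpleVertex Q v t) (hQ : Q.Finite) :
    dim (solutionSet Q) = n := by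
  simpa [tightFace] using h.dim_tightFace hQ ∅

/-- The edges at a simple vertex arise by dropping one of the `n` tight inequalities. -/
theorem encard_edges (h : IsSimpleVertex Q v t) (hQ : Q.Finite) :
    {F | IsEdge (solutionSet Q) F ∧ v ∈ F}.encard = n := by
  have heq : {F | IsEdge (solutionSet Q) F ∧ v ∈ F} =
      Set.range fun j : Fin n => tightFace Q t {j}ᶜ := by
    ext F
    constructor
    · rintro ⟨⟨hF, hdim⟩, hv⟩
      obtain ⟨A, rfl⟩ := h.exists_tightFace hQ hF hv
      have h1 := h.dim_tightFace hQ A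
      have h2 := A.card_add_card_compl
      rw [Fintype.card_fin] at h2
      obtain ⟨j, hj⟩ := Finset.card_eq_one.1 (show Aᶜ.card = 1 by omega)
      exact ⟨j, by simp only [← hj, compl_compl]⟩
    · rintro ⟨j, rfl⟩
      refine ⟨⟨h.isFace_tightFace _, ?_⟩, h.mem_tightFace _⟩
      dsimp only
      have h1 := h.dim_tightFace hQ {j}ᶜ
      have h2 := Finset.card_add_card_compl ({j} : Finset (Fin n))
      rw [Fintype.card_fin, Finset.card_singleton] at h2
      omega
  have hinj : Function.Injective fun j : Fin n => tightFace Q t {j}ᶜ :=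
    (h.tightFace_injective hQ).comp (compl_injective.comp Finset.singleton_injective)
  rw [heq, ← Set.image_univ, hinj.encard_image, Set.encard_univ, ENat.card_eq_coe_fintype_card,
    Fintype.card_fin]

theorem tightFace_singleton (i : Fin n) :
    tightFace Q t {i} = {x ∈ solutionSet Q | (t i).Tight x} := by
  simp [tightFace]

theorem isFacet_of_tight (h : IsSimpleVertex Q v t) (hQ : Q.Finite) {q : LinIneq n} (hq : q ∈ Q)
    (hqv : q.Tight v) : IsFacet (solutionSet Q) {x ∈ solutionSet Q | q.Tight x} := by
  obtain ⟨i, rfl⟩ := (h.tight_iff q hq).1 hqv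
  rw [← tightFace_singleton]
  refine ⟨h.isFace_tightFace _, ?_⟩
  rw [h.dim_solutionSet hQ]
  simpa using h.dim_tightFace hQ {i}

/-- A facet through a simple vertex is the face of a single tight inequality. -/
theorem exists_eq_of_isFacet (h : IsSimpleVertex Q v t) (hQ : Q.Finite) {F : Set (Fin n → ℝ)}
    (hF : IsFacet (solutionSet Q) F) (hv : v ∈ F) :
    ∃ q ∈ Q, {x ∈ solutionSet Q | q.Tight x} = F := by
  obtain ⟨A, rfl⟩ := h.exists_tightFace hQ hF.1 hv
  have h1 := h.dim_tightFace hQ A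
  have h2 := hF.2
  rw [h.dim_solutionSet hQ] at h2
  obtain ⟨i, rfl⟩ := Finset.card_eq_one.1 (show A.card = 1 by omega)
  exact ⟨t i, h.mem i, (tightFace_singleton i).symm⟩

theorem eq_of_tight_eq (h : IsSimpleVertex Q v t) (hQ : Q.Finite) {q r : LinIneq n} (hq : q ∈ Q)
    (hr : r ∈ Q) (hqv : q.Tight v)
    (hqr : {x ∈ solutionSet Q | q.Tight x} = {x ∈ solutionSet Q | r.Tight x}) : q = r := by
  have hrv : r.Tight v := (hqr ▸ (⟨h.holds, hqv⟩ : v ∈ {x ∈ solutionSet Q | q.Tight x}) :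
    v ∈ {x ∈ solutionSet Q | r.Tight x}).2
  obtain ⟨i, rfl⟩ := (h.tight_iff q hq).1 hqv
  obtain ⟨j, rfl⟩ := (h.tight_iff r hr).1 hrv
  rw [← tightFace_singleton, ← tightFace_singleton] at hqr
  rw [Finset.singleton_injective (h.tightFace_injective hQ hqr)]

/-- An inequality that is tight at a simple vertex cannot be dropped: moving away from the vertex
against its direction violates it and no other inequality. -/
theorem solutionSet_ne (h : IsSimpleVertex Q v t) (hQ : Q.Finite) {q : LinIneq n} (hq : q ∈ Q)
    (hqv : q.Tight v) {R : Set (LinIneq n)} (hR : R ⊆ Q) (hqR : q ∉ R) :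
    solutionSet R ≠ solutionSet Q := by
  obtain ⟨d, hd⟩ := h.exists_directions
  obtain ⟨ε, hε, hmem⟩ := h.exists_pos_mem hQ hd
  obtain ⟨i, rfl⟩ := (h.tight_iff q hq).1 hqv
  intro heq
  have h1 : v - ε • d i ∈ solutionSet R := fun r hr =>
    (hmem i).2 r (hR hr) fun e => hqR (e ▸ hr)
  rw [heq] at h1
  have h2 := h1 _ hq
  rw [LinIneq.holds_iff, dotProduct_sub, dotProduct_smul, hd, h.tight] at h2
  simp at h2
  linarith

end IsSimpleVertex

/-! ### Partial sums -/

section PartialSums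

variable {n : ℕ} {b : Fin n → ℕ}

theorem S_strictMono (hb : ∀ i, 0 < b i) : StrictMono (S b) := by
  intro i j hij
  refine Finset.sum_lt_sum_of_subset (Finset.Iic_subset_Iic.2 hij.le) (i := j) (by simp)
    (by simpa using hij) (hb j) fun _ _ _ => Nat.zero_le _

theorem one_le_S (hb : ∀ i, 0 < b i) (i : Fin n) : 1 ≤ S b i :=
  (hb i).trans_le (Finset.single_le_sum (f := b) (fun _ _ => Nat.zero_le _) (by simp))

theorem S_eq_one_iff [NeZero n] (hb : ∀ i, 0 < b i) {i : Fin n} :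
    S b i = 1 ↔ i = 0 ∧ b 0 = 1 := by
  have h0 : S b 0 = b 0 := by
    have : Finset.Iic (0 : Fin n) = {0} := by
      ext j
      simp
    rw [S, this, Finset.sum_singleton]
  constructor
  · intro h
    have hi : i = 0 := by
      by_contra hne
      have h1 := S_strictMono hb (Fin.pos_iff_ne_zero.2 hne)
      have h2 := one_le_S hb 0
      omega
    subst hi
    exact ⟨rfl, h0 ▸ h⟩
  · rintro ⟨rfl, h⟩
    rw [h0, h]

theorem exists_card_eq_card_Ici {I : Finset (Fin n)} (hI : I.Nonempty) :
    ∃ j : Fin n, I.card = (Finset.Ici j).card := by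
  have h1 := hI.card_pos
  have h2 := Finset.card_le_univ I
  rw [Fintype.card_fin] at h2
  refine ⟨⟨n - I.card, by omega⟩, ?_⟩
  rw [Fin.card_Ici]
  simp only
  omega

theorem filter_eq_Ici (j : Fin n) :
    Finset.univ.filter (fun i : Fin n => n ≤ i.val + (Finset.Ici j).card) = Finset.Ici j := by
  ext i
  rw [Fin.card_Ici, Finset.mem_filter, Finset.mem_Ici, Fin.le_def]
  have := j.isLt
  simp only [Finset.mem_univ, true_and]
  omega

theorem topSum_card_Ici (j : Fin n) :
    topSum b (Finset.Ici j).card = ∑ i ∈ Finset.Ici j, S b i := by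
  rw [topSum, filter_eq_Ici]

/-- Subtracting `f j` from every term makes the terms in `Ici j` nonnegative and the others
nonpositive. -/
theorem sum_le_sum_Ici {f : Fin n → ℝ} (hf : Monotone f) {J : Finset (Fin n)} {j : Fin n}
    (hJ : J.card = (Finset.Ici j).card) : ∑ i ∈ J, f i ≤ ∑ i ∈ Finset.Ici j, f i := by
  have h : ∑ i ∈ J, (f i - f j) ≤ ∑ i ∈ Finset.Ici j, (f i - f j) := by
    rw [← Finset.sum_inter_add_sum_sdiff J (Finset.Ici j)]
    have h1 : ∑ i ∈ J \ Finset.Ici j, (f i - f j) ≤ 0 := Finset.sum_nonpos fun i hi => by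
      have : i < j := by simpa using (Finset.mem_sdiff.1 hi).2
      exact sub_nonpos.2 (hf this.le)
    have h2 : ∑ i ∈ J ∩ Finset.Ici j, (f i - f j) ≤ ∑ i ∈ Finset.Ici j, (f i - f j) :=
      Finset.sum_le_sum_of_subset_of_nonneg Finset.inter_subset_right fun i hi _ =>
        sub_nonneg.2 (hf (Finset.mem_Ici.1 hi))
    linarith
  simpa [Finset.sum_sub_distrib, hJ] using h

/-- The set `Ici j` is the only maximizer: for strictly monotone `f` the terms outside `Ici j` are
negative. -/
theorem eq_Ici_of_sum_le {f : Fin n → ℝ} (hf : StrictMono f) {J : Finset (Fin n)} {j : Fin n}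
    (hJ : J.card = (Finset.Ici j).card) (hsum : ∑ i ∈ Finset.Ici j, f i ≤ ∑ i ∈ J, f i) :
    J = Finset.Ici j := by
  refine Finset.eq_of_subset_of_card_le (fun l hl => ?_) hJ.ge
  by_contra hlj
  have h : ∑ i ∈ J, (f i - f j) < ∑ i ∈ Finset.Ici j, (f i - f j) := by
    rw [← Finset.sum_inter_add_sum_sdiff J (Finset.Ici j)]
    have h1 : ∑ i ∈ J \ Finset.Ici j, (f i - f j) < 0 := by
      refine Finset.sum_neg (fun i hi => ?_) ⟨l, Finset.mem_sdiff.2 ⟨hl, hlj⟩⟩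
      have : i < j := by simpa using (Finset.mem_sdiff.1 hi).2
      exact sub_neg.2 (hf this)
    have h2 : ∑ i ∈ J ∩ Finset.Ici j, (f i - f j) ≤ ∑ i ∈ Finset.Ici j, (f i - f j) :=
      Finset.sum_le_sum_of_subset_of_nonneg Finset.inter_subset_right fun i hi _ =>
        sub_nonneg.2 (hf.monotone (Finset.mem_Ici.1 hi))
    linarith
  simp only [Finset.sum_sub_distrib, Finset.sum_const, hJ] at h
  linarith

theorem S_real_strictMono (hb : ∀ i, 0 < b i) : StrictMono fun i => (S b i : ℝ) :=
  fun _ _ hij => Nat.cast_lt.2 (S_strictMono hb hij)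

theorem sum_S_le_topSum (hb : ∀ i, 0 < b i) {J : Finset (Fin n)} (hJ : J.Nonempty) :
    ∑ i ∈ J, (S b i : ℝ) ≤ topSum b J.card := by
  obtain ⟨j, hj⟩ := exists_card_eq_card_Ici hJ
  rw [hj, topSum_card_Ici, Nat.cast_sum]
  exact sum_le_sum_Ici (S_real_strictMono hb).monotone hj

/-- Each `b l` is counted once for every `i ≥ l` among the last `|I|` indices. -/
theorem topSum_eq_sum_min (b : Fin n → ℕ) {I : Finset (Fin n)} (hI : I.Nonempty) :
    topSum b I.card = ∑ j : Fin n, min ((j : ℕ) + 1) I.card * b (Fin.rev j) := by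
  obtain ⟨j, hj⟩ := exists_card_eq_card_Ici hI
  rw [hj, topSum_card_Ici, ← Equiv.sum_comp Fin.revPerm]
  simp only [S]
  rw [Finset.sum_comm' (t' := Finset.univ) (s' := fun l => Finset.Ici (max l j))
    (fun x y => by simp [and_comm])]
  refine Finset.sum_congr rfl fun l _ => ?_
  have h1 := l.isLt
  have h2 := j.isLt
  rw [Finset.sum_const, smul_eq_mul, Fin.revPerm_apply, Fin.rev_rev, Fin.card_Ici, Fin.card_Ici,
    Fin.val_rev, Fin.coe_max]
  congr 1
  omega

end PartialSums

/-! ### The inequalities and the candidate vertices -/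

section System

variable {n : ℕ} {b : Fin n → ℕ}

theorem lowerIneq_dotProduct (i : Fin n) (x : Fin n → ℝ) : (lowerIneq i).normal ⬝ᵥ x = -x i := by
  simp [lowerIneq, dotProduct]

theorem upperIneq_dotProduct (I : Finset (Fin n)) (x : Fin n → ℝ) :
    (upperIneq b I).normal ⬝ᵥ x = ∑ i ∈ I, x i := by
  simp [upperIneq, dotProduct]

theorem lowerIneq_holds_iff {i : Fin n} {x : Fin n → ℝ} : (lowerIneq i).Holds x ↔ 1 ≤ x i := by
  rw [LinIneq.holds_iff, lowerIneq_dotProduct]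
  exact neg_le_neg_iff

theorem lowerIneq_tight_iff {i : Fin n} {x : Fin n → ℝ} : (lowerIneq i).Tight x ↔ x i = 1 := by
  rw [LinIneq.tight_iff, lowerIneq_dotProduct]
  exact neg_inj

theorem upperIneq_holds_iff {I : Finset (Fin n)} {x : Fin n → ℝ} :
    (upperIneq b I).Holds x ↔ ∑ i ∈ I, x i ≤ topSum b I.card := by
  rw [LinIneq.holds_iff, upperIneq_dotProduct]
  rfl

theorem upperIneq_tight_iff {I : Finset (Fin n)} {x : Fin n → ℝ} :
    (upperIneq b I).Tight x ↔ ∑ i ∈ I, x i = topSum b I.card := by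
  rw [LinIneq.tight_iff, upperIneq_dotProduct]
  rfl

/-- The points `π(y_k)`, which turn out to be the vertices of the polytope. -/
def candidates (b : Fin n → ℕ) : Set (Fin n → ℝ) :=
  {v | ∃ (π : Equiv.Perm (Fin n)) (k : ℕ), k ≤ n ∧ v = permute π (y b k)}

theorem candidates_finite (b : Fin n → ℕ) : (candidates b).Finite := by
  refine (Set.finite_range fun p : Equiv.Perm (Fin n) × Fin (n + 1) =>
    permute p.1 (y b p.2)).subset ?_
  rintro _ ⟨π, k, hk, rfl⟩
  exact ⟨(π, ⟨k, Nat.lt_succ_of_le hk⟩), rfl⟩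

theorem permute_apply_perm (π : Equiv.Perm (Fin n)) (x : Fin n → ℝ) (i : Fin n) :
    permute π x (π i) = x i := by
  simp [permute]

theorem y_le_S (hb : ∀ i, 0 < b i) (k : ℕ) (i : Fin n) : y b k i ≤ S b i := by
  rw [y]
  split_ifs
  · exact_mod_cast one_le_S hb i
  · rfl

theorem candidates_subset_X (hb : ∀ i, 0 < b i) : candidates b ⊆ X b := by
  rintro _ ⟨π, k, -, rfl⟩
  refine subset_convexHull ℝ _ ⟨fun i => if (π.symm i : ℕ) < k then 1 else S b (π.symm i),
    ⟨fun i => ?_, π, fun i j hij => ?_, fun i => ?_⟩, ?_⟩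
  · have := one_le_S hb (π.symm i)
    dsimp only
    split_ifs <;> omega
  · have h1 := (S_strictMono hb).monotone hij
    have h2 := one_le_S hb j
    have h3 : (i : ℕ) ≤ j := hij
    simp only [Function.comp_apply, Equiv.symm_apply_apply]
    split_ifs <;> omega
  · have := one_le_S hb i
    simp only [Equiv.symm_apply_apply]
    split_ifs <;> omega
  · ext i
    simp [permute, y]

theorem convex_solutionSet (Q : Set (LinIneq n)) : Convex ℝ (solutionSet Q) := by
  intro x hx z hz α β hα hβ hαβ q hq
  have h1 : q.normal ⬝ᵥ x ≤ q.bound := hx q hq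
  have h2 : q.normal ⬝ᵥ z ≤ q.bound := hz q hq
  rw [LinIneq.holds_iff, dotProduct_add, dotProduct_smul, dotProduct_smul, smul_eq_mul,
    smul_eq_mul]
  calc _ ≤ α * q.bound + β * q.bound :=
        add_le_add (mul_le_mul_of_nonneg_left h1 hα) (mul_le_mul_of_nonneg_left h2 hβ)
    _ = q.bound := by rw [← add_mul, hαβ, one_mul]

variable [NeZero n]

theorem parkingSystem_finite (b : Fin n → ℕ) : (parkingSystem b).Finite := by
  refine Set.Finite.union ((Set.finite_range lowerIneq).subset ?_)
    ((Set.finite_range (upperIneq b)).subset ?_)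
  · rintro _ ⟨i, rfl⟩
    exact ⟨i, rfl⟩
  · rintro _ ⟨I, -, -, rfl⟩
    exact ⟨I, rfl⟩

/-- Rearranged, the values of a parking function on `I` are bounded by `|I|` distinct partial sums,
which add up to at most the sum of the last `|I|` partial sums. -/
theorem X_subset_solutionSet (hb : ∀ i, 0 < b i) : X b ⊆ solutionSet (parkingSystem b) := by
  refine convexHull_min ?_ (convex_solutionSet _)
  rintro _ ⟨β, ⟨hpos, σ, -, hσ⟩, rfl⟩ q (⟨i, rfl⟩ | ⟨I, hI, -, rfl⟩)
  · rw [lowerIneq_holds_iff]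
    exact_mod_cast hpos i
  · rw [upperIneq_holds_iff]
    calc ∑ i ∈ I, (β i : ℝ) = ∑ i ∈ I.map σ.symm.toEmbedding, (β (σ i) : ℝ) := by simp
      _ ≤ ∑ i ∈ I.map σ.symm.toEmbedding, (S b i : ℝ) :=
        Finset.sum_le_sum fun i _ => Nat.cast_le.2 (hσ i)
      _ ≤ topSum b (I.map σ.symm.toEmbedding).card := sum_S_le_topSum hb (hI.map)
      _ = topSum b I.card := by rw [Finset.card_map]

theorem sum_le_topSum_of_card_ne {x : Fin n → ℝ} (hx : x ∈ solutionSet (parkingSystem b))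
    {I : Finset (Fin n)} (hI : I.Nonempty) (hcard : b 0 = 1 → I.card ≠ n - 1) :
    ∑ i ∈ I, x i ≤ topSum b I.card :=
  upperIneq_holds_iff.1 (hx _ (Or.inr ⟨I, hI, hcard, rfl⟩))

/-- The inequalities left out when `b 0 = 1` follow from those of the full index set and of the
missing coordinate. -/
theorem sum_le_topSum (hb : ∀ i, 0 < b i) {x : Fin n → ℝ}
    (hx : x ∈ solutionSet (parkingSystem b)) {I : Finset (Fin n)} (hI : I.Nonempty) :
    ∑ i ∈ I, x i ≤ topSum b I.card := by
  by_cases h : b 0 = 1 → I.card ≠ n - 1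
  · exact sum_le_topSum_of_card_ne hx hI h
  push Not at h
  obtain ⟨h0, hcard⟩ := h
  have hn := NeZero.pos n
  have hIpos := hI.card_pos
  have h1 := sum_le_topSum_of_card_ne hx Finset.univ_nonempty
    (fun _ => by rw [Finset.card_univ, Fintype.card_fin]; omega)
  have h2 := I.card_add_card_compl
  rw [Fintype.card_fin] at h2
  obtain ⟨j, hj⟩ := Finset.card_eq_one.1 (show Iᶜ.card = 1 by omega)
  have h3 : (1 : ℝ) ≤ x j := lowerIneq_holds_iff.1 (hx _ (Or.inl ⟨j, rfl⟩))
  have h4 := Finset.sum_add_sum_compl I x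
  rw [hj, Finset.sum_singleton] at h4
  have h5 : topSum b (Finset.univ : Finset (Fin n)).card = topSum b I.card + 1 := by
    rw [← (S_eq_one_iff hb).2 ⟨rfl, h0⟩, topSum, topSum, hcard, Finset.card_univ, Fintype.card_fin]
    have hu : Finset.univ.filter (fun i : Fin n => n ≤ i.val + n) = Finset.univ := by
      ext i
      simp
    have he : Finset.univ.filter (fun i : Fin n => n ≤ i.val + (n - 1)) = Finset.univ.erase 0 := by
      ext i
      simp only [Finset.mem_filter, Finset.mem_univ, true_and, Finset.mem_erase, and_true, Ne,
        Fin.ext_iff, Fin.val_zero]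
      omega
    rw [hu, he, Finset.sum_erase_add _ _ (Finset.mem_univ _)]
  rw [h5] at h1
  push_cast at h1
  linarith

end System

/-! ### Linear functionals are maximal at candidate vertices -/

/-- Summation by parts: peel off the smallest coefficient. -/
theorem sum_mul_nonpos_of_tail_sums_nonpos : ∀ {n : ℕ} {c d : Fin n → ℝ}, Monotone c →
    (∀ i, 0 ≤ c i) → (∀ j, ∑ i ∈ Finset.Ici j, d i ≤ 0) → ∑ i, c i * d i ≤ 0
  | 0, _, _, _, _, _ => by simp
  | n + 1, c, d, hc, hc0, hd => by
    have hsucc : ∀ j : Fin n, ∑ i ∈ Finset.Ici j, d i.succ ≤ 0 := fun j => by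
      have := hd j.succ
      rwa [← Fin.map_succEmb_Ici, Finset.sum_map] at this
    have hall : ∑ i, d i ≤ 0 := by
      have h0 : Finset.Ici (0 : Fin (n + 1)) = Finset.univ := by
        ext
        simp
      exact h0 ▸ hd 0
    have ih := sum_mul_nonpos_of_tail_sums_nonpos (c := fun i => c i.succ - c 0)
      (fun i j hij => sub_le_sub_right (hc (Fin.succ_le_succ_iff.2 hij)) _)
      (fun i => sub_nonneg.2 (hc (Fin.zero_le _))) hsucc
    have heq : ∑ i, c i * d i =
        c 0 * ∑ i, d i + ∑ i : Fin n, (c i.succ - c 0) * d i.succ := by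
      simp only [Fin.sum_univ_succ, sub_mul, Finset.sum_sub_distrib, mul_add, Finset.mul_sum]
      ring
    rw [heq]
    exact add_nonpos (mul_nonpos_of_nonneg_of_nonpos (hc0 0) hall) ih

section Greedy

variable {n : ℕ} [NeZero n] {b : Fin n → ℕ}

/-- Sort the coefficients of the functional. With `k` of them nonpositive, `y_k` takes the least
possible values on these, and its tail sums on the others are the largest possible ones. -/
theorem exists_candidate_ge (hb : ∀ i, 0 < b i) (c : Fin n → ℝ) {x : Fin n → ℝ}
    (hx : x ∈ solutionSet (parkingSystem b)) : ∃ v ∈ candidates b, c ⬝ᵥ x ≤ c ⬝ᵥ v := by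
  set σ := Tuple.sort c
  have hmono : Monotone (c ∘ σ) := Tuple.monotone_sort c
  obtain ⟨k, hkn, hk⟩ : ∃ k ≤ n, ∀ i : Fin n, (i : ℕ) < k ↔ c (σ i) ≤ 0 := by
    refine ⟨(Finset.univ.filter fun i => (c ∘ σ) i ≤ 0).card, ?_, fun i =>
      Tuple.lt_card_le_iff_apply_le_of_monotone hmono⟩
    simpa using Finset.card_le_univ (Finset.univ.filter fun i => (c ∘ σ) i ≤ 0)
  refine ⟨permute σ (y b k), ⟨σ, k, hkn, rfl⟩, ?_⟩
  have hdot : ∀ z : Fin n → ℝ, c ⬝ᵥ z = ∑ i, c (σ i) * z (σ i) := fun z =>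
    (Equiv.sum_comp σ fun i => c i * z i).symm
  rw [hdot, hdot, ← sub_nonpos, ← Finset.sum_sub_distrib]
  simp only [permute_apply_perm, ← mul_sub]
  -- the differences, with the coordinates of nonpositive coefficient removed
  let d : Fin n → ℝ := fun i => if (i : ℕ) < k then 0 else x (σ i) - S b i
  have hle : ∀ i, c (σ i) * (x (σ i) - y b k i) ≤ max (c (σ i)) 0 * d i := fun i => by
    by_cases hi : (i : ℕ) < k
    · have h1 : (1 : ℝ) ≤ x (σ i) := lowerIneq_holds_iff.1 (hx _ (Or.inl ⟨σ i, rfl⟩))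
      simp only [y, d, hi, if_true, mul_zero]
      exact mul_nonpos_of_nonpos_of_nonneg ((hk i).1 hi) (sub_nonneg.2 h1)
    · have h1 := not_le.1 (mt (hk i).2 hi)
      simp only [y, d, hi, if_false, max_eq_left h1.le]
      rfl
  refine (Finset.sum_le_sum fun i _ => hle i).trans
    (sum_mul_nonpos_of_tail_sums_nonpos
      (fun i j hij => max_le_max (hmono hij) le_rfl) (fun i => le_max_right _ _) fun j => ?_)
  have htail : ∀ j : Fin n, ∑ i ∈ Finset.Ici j, (x (σ i) - S b i) ≤ 0 := fun j => by
    have h1 := sum_le_topSum hb hx (I := (Finset.Ici j).map σ.toEmbedding)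
      (Finset.nonempty_Ici.map)
    rw [Finset.card_map, topSum_card_Ici, Finset.sum_map, Nat.cast_sum] at h1
    rw [Finset.sum_sub_distrib]
    exact sub_nonpos.2 h1
  have hd : ∑ i ∈ Finset.Ici j, d i =
      ∑ i ∈ (Finset.Ici j).filter (fun i : Fin n => ¬ (i : ℕ) < k), (x (σ i) - S b i) := by
    rw [Finset.sum_filter]
    exact Finset.sum_congr rfl fun i _ => by simp only [d]; split_ifs <;> rfl
  rw [hd]
  by_cases hkn' : k < n
  · have : (Finset.Ici j).filter (fun i : Fin n => ¬ (i : ℕ) < k) =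
        Finset.Ici (max j ⟨k, hkn'⟩) := by
      ext i
      rw [Finset.mem_filter, Finset.mem_Ici, Finset.mem_Ici, max_le_iff, not_lt]
      rfl
    rw [this]
    exact htail _
  · rw [Finset.filter_false_of_mem, Finset.sum_empty]
    intro i _
    have := i.isLt
    omega

theorem exists_candidate_ge_of_dual (hb : ∀ i, 0 < b i) (l : StrongDual ℝ (Fin n → ℝ))
    {x : Fin n → ℝ} (hx : x ∈ solutionSet (parkingSystem b)) :
    ∃ v ∈ candidates b, l x ≤ l v := by
  have hdot : ∀ z, l z = (fun i => l (Pi.single i 1)) ⬝ᵥ z := fun z => by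
    conv_lhs => rw [pi_eq_sum_univ' z]
    simp [dotProduct, mul_comm]
  obtain ⟨v, hv, hle⟩ := exists_candidate_ge hb (fun i => l (Pi.single i 1)) hx
  rw [← hdot, ← hdot] at hle
  exact ⟨v, hv, hle⟩

/-- A solution outside the convex hull would be separated from it by a functional exceeding all its
values at the candidates, and there is no such functional. -/
theorem solutionSet_parkingSystem (hb : ∀ i, 0 < b i) :
    solutionSet (parkingSystem b) = convexHull ℝ (candidates b) := by
  apply subset_antisymm
  · intro x hx
    by_contra hxc
    obtain ⟨l, u, hl, hu⟩ := geometric_hahn_banach_closed_point (convex_convexHull ℝ _)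
      ((candidates_finite b).isClosed_convexHull ℝ) hxc
    obtain ⟨v, hv, hle⟩ := exists_candidate_ge_of_dual hb l hx
    have := hl v (subset_convexHull ℝ _ hv)
    linarith
  · exact (convexHull_min (candidates_subset_X hb) (convex_convexHull ℝ _)).trans
      (X_subset_solutionSet hb)

theorem X_eq_solutionSet (hb : ∀ i, 0 < b i) : X b = solutionSet (parkingSystem b) := by
  refine (X_subset_solutionSet hb).antisymm ?_
  rw [solutionSet_parkingSystem hb]
  exact convexHull_min (candidates_subset_X hb) (convex_convexHull ℝ _)

end Greedy

/-! ### The candidate vertices are simple -/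

section Tight

variable {n : ℕ} {b : Fin n → ℕ}

/-- Each entry is a difference of two consecutive tail sums, so the entries vanish one after the
other from the last one downwards. -/
theorem eq_zero_of_tail_sums {z : Fin n → ℝ}
    (h : ∀ i, z i = 0 ∨ ∑ l ∈ Finset.Ici i, z l = 0) (i : Fin n) : z i = 0 := by
  induction i using WellFoundedGT.induction with
  | ind i ih =>
    refine (h i).elim id fun hi => ?_
    rwa [← Finset.sum_erase_add _ _ (Finset.mem_Ici.2 le_rfl), Finset.sum_eq_zero, zero_add] at hi
    intro l hl
    rw [Finset.mem_erase, Finset.mem_Ici] at hl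
    exact ih l (lt_of_le_of_ne hl.2 hl.1.symm)

theorem upperIneq_map_tight_iff {π : Equiv.Perm (Fin n)} {k : ℕ} {j : Fin n}
    (hb : ∀ i, 0 < b i) :
    (upperIneq b ((Finset.Ici j).map π.toEmbedding)).Tight (permute π (y b k)) ↔
      ∀ i, j ≤ i → y b k i = S b i := by
  rw [upperIneq_tight_iff, Finset.card_map, topSum_card_Ici, Finset.sum_map, Nat.cast_sum]
  simp only [Equiv.coe_toEmbedding, permute_apply_perm]
  rw [Finset.sum_eq_sum_iff_of_le fun i _ => y_le_S hb k i]
  simp only [Finset.mem_Ici]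

/-- Since the partial sums are strictly increasing, an upper inequality is tight at `π(y_k)` only if
`π` maps the last `|I|` indices onto `I`. -/
theorem exists_eq_map_Ici_of_tight (hb : ∀ i, 0 < b i) {π : Equiv.Perm (Fin n)} {k : ℕ}
    {I : Finset (Fin n)} (hI : I.Nonempty) (h : (upperIneq b I).Tight (permute π (y b k))) :
    ∃ j : Fin n, I = (Finset.Ici j).map π.toEmbedding := by
  obtain ⟨j, hj⟩ := exists_card_eq_card_Ici hI
  refine ⟨j, ?_⟩
  rw [upperIneq_tight_iff, hj, topSum_card_Ici, Nat.cast_sum] at h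
  have hJ : I.map π.symm.toEmbedding = Finset.Ici j := by
    refine eq_Ici_of_sum_le (S_real_strictMono hb) (by rw [Finset.card_map, hj]) ?_
    rw [← h, Finset.sum_map]
    exact Finset.sum_le_sum fun i _ => y_le_S hb k _
  rw [← hJ, Finset.map_map]
  ext i
  simp

variable [NeZero n]

theorem y_eq_one_iff (hb : ∀ i, 0 < b i) {k : ℕ} {i : Fin n} :
    y b k i = 1 ↔ (i : ℕ) < k ∨ i = 0 ∧ b 0 = 1 := by
  rw [← S_eq_one_iff hb, y]
  split_ifs with h
  · simp [h]
  · simp [h]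

theorem y_eq_S_iff (hb : ∀ i, 0 < b i) {k : ℕ} {i : Fin n} :
    y b k i = S b i ↔ k ≤ (i : ℕ) ∨ i = 0 ∧ b 0 = 1 := by
  rw [← S_eq_one_iff hb, y]
  split_ifs with h
  · simp only [not_le.2 h, false_or]
    rw [eq_comm]
    exact_mod_cast Iff.rfl
  · simp [not_lt.1 h]

/-- The inequalities that are tight at `π(y_k)`, in the case that `y_k` is not affected by
`S_1 = 1`. -/
theorem isSimpleVertex_of_ne (hb : ∀ i, 0 < b i) (π : Equiv.Perm (Fin n)) {k : ℕ} (hk : k ≤ n)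
    (hbk : b 0 = 1 → 2 ≤ k) :
    IsSimpleVertex (parkingSystem b) (permute π (y b k)) fun i =>
      if (i : ℕ) < k then lowerIneq (π i)
      else upperIneq b ((Finset.Ici i).map π.toEmbedding) where
  holds := X_subset_solutionSet hb (candidates_subset_X hb ⟨π, k, hk, rfl⟩)
  mem i := by
    split_ifs with hi
    · exact Or.inl ⟨_, rfl⟩
    · refine Or.inr ⟨_, Finset.nonempty_Ici.map, fun h0 => ?_, rfl⟩
      have := hbk h0
      rw [Finset.card_map, Fin.card_Ici]
      omega
  tight_iff q hq := by
    constructor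
    · intro hqv
      obtain ⟨i, rfl⟩ | ⟨I, hI, -, rfl⟩ := hq
      · obtain ⟨i, rfl⟩ := π.surjective i
        rw [lowerIneq_tight_iff, permute_apply_perm, y_eq_one_iff hb] at hqv
        refine ⟨i, if_pos (hqv.elim id ?_)⟩
        rintro ⟨rfl, h0⟩
        have := hbk h0
        rw [Fin.val_zero]
        omega
      · obtain ⟨j, rfl⟩ := exists_eq_map_Ici_of_tight hb hI hqv
        rw [upperIneq_map_tight_iff hb] at hqv
        refine ⟨j, if_neg fun hj => ?_⟩
        obtain h | ⟨rfl, h0⟩ := (y_eq_S_iff hb).1 (hqv j le_rfl)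
        · omega
        -- for `j = 0` the second entry of `y_k` is `1`, which is less than its bound
        · have h2 := hbk h0
          have h1 := (y_eq_S_iff hb).1 (hqv ⟨1, by omega⟩ (Fin.zero_le _))
          simp only [Fin.ext_iff, Fin.val_zero] at h1
          omega
    · rintro ⟨i, rfl⟩
      dsimp only
      split_ifs with hi
      · rw [lowerIneq_tight_iff, permute_apply_perm, y_eq_one_iff hb]
        exact Or.inl hi
      · rw [upperIneq_map_tight_iff hb]
        exact fun l hl => (y_eq_S_iff hb).2 (Or.inl ((not_lt.1 hi).trans hl))
  eq_zero x hx := by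
    have hz : ∀ i, x (π i) = 0 := eq_zero_of_tail_sums fun i => by
      have h := hx i
      split_ifs at h with hi
      · rw [lowerIneq_dotProduct] at h
        exact Or.inl (neg_eq_zero.1 h)
      · rw [upperIneq_dotProduct, Finset.sum_map] at h
        exact Or.inr h
    ext i
    simpa using hz (π.symm i)

/-- For `S_1 = 1` and `k ≤ 1` the last `n - 1` entries of `y_k` are the last `n - 1` partial sums,
but the inequality which this makes tight is left out of the system. The coordinate equal to `1`
contributes a lower bound in its place. -/
theorem isSimpleVertex_of_eq (hb : ∀ i, 0 < b i) (π : Equiv.Perm (Fin n)) {k : ℕ} (hk : k ≤ 1)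
    (h0 : b 0 = 1) (hn : 2 ≤ n) :
    IsSimpleVertex (parkingSystem b) (permute π (y b k)) fun i =>
      if (i : ℕ) = 1 then lowerIneq (π 0)
      else upperIneq b ((Finset.Ici i).map π.toEmbedding) where
  holds := X_subset_solutionSet hb (candidates_subset_X hb ⟨π, k, by omega, rfl⟩)
  mem i := by
    split_ifs with hi
    · exact Or.inl ⟨_, rfl⟩
    · refine Or.inr ⟨_, Finset.nonempty_Ici.map, fun _ => ?_, rfl⟩
      have := i.isLt
      rw [Finset.card_map, Fin.card_Ici]
      omega
  tight_iff q hq := by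
    constructor
    · intro hqv
      obtain ⟨i, rfl⟩ | ⟨I, hI, hcard, rfl⟩ := hq
      · obtain ⟨i, rfl⟩ := π.surjective i
        rw [lowerIneq_tight_iff, permute_apply_perm, y_eq_one_iff hb] at hqv
        have hi : i = 0 := by
          obtain h | h := hqv
          · rw [Fin.ext_iff, Fin.val_zero]
            omega
          · exact h.1
        exact ⟨⟨1, hn⟩, by simp [hi]⟩
      · obtain ⟨j, rfl⟩ := exists_eq_map_Ici_of_tight hb hI hqv
        refine ⟨j, if_neg fun hj => hcard h0 ?_⟩
        rw [Finset.card_map, Fin.card_Ici, hj]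
    · rintro ⟨i, rfl⟩
      dsimp only
      split_ifs with hi
      · rw [lowerIneq_tight_iff, permute_apply_perm, y_eq_one_iff hb]
        exact Or.inr ⟨rfl, h0⟩
      · rw [upperIneq_map_tight_iff hb]
        refine fun l _ => (y_eq_S_iff hb).2 ?_
        by_cases hl : l = 0
        · exact Or.inr ⟨hl, h0⟩
        · rw [Fin.ext_iff, Fin.val_zero] at hl
          exact Or.inl (by omega)
  eq_zero x hx := by
    have hlow : x (π 0) = 0 := by
      have h := hx ⟨1, hn⟩
      rw [if_pos rfl, lowerIneq_dotProduct] at h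
      exact neg_eq_zero.1 h
    have hsum : ∀ i : Fin n, (i : ℕ) ≠ 1 → ∑ l ∈ Finset.Ici i, x (π l) = 0 := fun i hi => by
      have h := hx i
      rw [if_neg hi, upperIneq_dotProduct, Finset.sum_map] at h
      exact h
    have hz : ∀ i, x (π i) = 0 := eq_zero_of_tail_sums fun i => by
      by_cases hi : (i : ℕ) = 1
      -- the first summand of the full sum vanishes, so the tail sum from the index `1` does
      · have h1 := hsum 0 (by rw [Fin.val_zero]; omega)
        rw [← Finset.sum_erase_add _ _ (Finset.mem_Ici.2 le_rfl), hlow, add_zero] at h1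
        have h2 : (Finset.Ici (0 : Fin n)).erase 0 = Finset.Ici i := by
          ext l
          simp only [Finset.mem_erase, Finset.mem_Ici, Ne, Fin.ext_iff, Fin.le_def, Fin.val_zero]
          omega
        rw [h2] at h1
        exact Or.inr h1
      · exact Or.inr (hsum i hi)
    ext i
    simpa using hz (π.symm i)

/-- For `n = 1` and `b_1 = 1` the polytope is a point, at which the lower and the upper bound are
both tight; this case has to be excluded. -/
theorem exists_isSimpleVertex (hb : ∀ i, 0 < b i) (hdeg : ¬ (n = 1 ∧ b 0 = 1)) {v : Fin n → ℝ}
    (hv : v ∈ candidates b) : ∃ t, IsSimpleVertex (parkingSystem b) v t := by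
  obtain ⟨π, k, hk, rfl⟩ := hv
  by_cases h : b 0 = 1 → 2 ≤ k
  · exact ⟨_, isSimpleVertex_of_ne hb π hk h⟩
  · push Not at h
    have hn := NeZero.pos n
    exact ⟨_, isSimpleVertex_of_eq hb π (by omega) h.1
      (by by_contra hn2; exact hdeg ⟨by omega, h.1⟩)⟩

/-- The lower bounds are tight at `y_n = (1, …, 1)`, and the upper inequalities at permutations of
`y_0 = (S_1, …, S_n)`. -/
theorem exists_tight_candidate (hb : ∀ i, 0 < b i) {q : LinIneq n} (hq : q ∈ parkingSystem b) :
    ∃ v ∈ candidates b, q.Tight v := by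
  obtain ⟨i, rfl⟩ | ⟨I, hI, -, rfl⟩ := hq
  · refine ⟨_, ⟨1, n, le_rfl, rfl⟩, ?_⟩
    rw [lowerIneq_tight_iff]
    simp [permute, y]
  · obtain ⟨j, hj⟩ := exists_card_eq_card_Ici hI
    let e : {x // x ∈ Finset.Ici j} ≃ {x // x ∈ I} := Finset.equivOfCardEq hj.symm
    obtain ⟨π, rfl⟩ : ∃ π : Equiv.Perm (Fin n), (Finset.Ici j).map π.toEmbedding = I := by
      refine ⟨e.extendSubtype, Finset.eq_of_subset_of_card_le (fun x hx => ?_)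
        (by rw [Finset.card_map, hj])⟩
      obtain ⟨i, hi, rfl⟩ := Finset.mem_map.1 hx
      exact e.extendSubtype_mem i hi
    refine ⟨_, ⟨π, 0, Nat.zero_le n, rfl⟩, ?_⟩
    rw [upperIneq_map_tight_iff hb]
    exact fun i _ => by simp [y]

end Tight

end ParkingPolytope

/-! ### The structure of the polytope -/

open ParkingPolytope

theorem mainTheorem1 (n : ℕ) [NeZero n] (b : Fin n → ℕ) (hb : ∀ i, 0 < b i)
    (hdeg : ¬ (n = 1 ∧ b 0 = 1)) :
    -- the polytope is full-dimensional and simple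
    (ParkingPolytope.dim (ParkingPolytope.X b) = n ∧
      ParkingPolytope.IsSimplePolytope (ParkingPolytope.X b)) ∧
    -- its vertices
    ParkingPolytope.vertices (ParkingPolytope.X b) =
      {v | ∃ (π : Equiv.Perm (Fin n)) (k : ℕ), k ≤ n ∧
        v = ParkingPolytope.permute π (ParkingPolytope.y b k)} ∧
    -- the minimal inequality description, and the second form of the right-hand sides
    ParkingPolytope.IsMinimalDescription (ParkingPolytope.parkingSystem b)
      (ParkingPolytope.X b) ∧
    (∀ I : Finset (Fin n), I.Nonempty →
      ParkingPolytope.topSum b I.card =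
        ∑ j : Fin n, min ((j : ℕ) + 1) I.card * b (Fin.rev j)) ∧
    -- each inequality defines a facet, and each facet is defined by exactly one of them
    Set.BijOn (fun q : ParkingPolytope.LinIneq n => {x ∈ ParkingPolytope.X b | q.Tight x})
      (ParkingPolytope.parkingSystem b)
      {F | ParkingPolytope.IsFacet (ParkingPolytope.X b) F} := by
  rw [X_eq_solutionSet hb]
  have hQ := parkingSystem_finite b
  have hconv := solutionSet_parkingSystem hb
  have hsimple : ∀ v ∈ candidates b, ∃ t, IsSimpleVertex (parkingSystem b) v t :=
    fun v hv => exists_isSimpleVertex hb hdeg hv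
  have hvert : vertices (solutionSet (parkingSystem b)) = candidates b := by
    refine subset_antisymm ?_ fun v hv => ?_
    · rw [hconv]
      exact extremePoints_convexHull_subset
    · obtain ⟨t, ht⟩ := hsimple v hv
      exact ht.mem_vertices
  have hdim : dim (solutionSet (parkingSystem b)) = n := by
    obtain ⟨t, ht⟩ := hsimple _ ⟨1, 0, Nat.zero_le n, rfl⟩
    exact ht.dim_solutionSet hQ
  refine ⟨⟨hdim, ⟨candidates b, candidates_finite b, hconv⟩, fun v hv => ?_⟩, hvert,
    ⟨rfl, fun R hR => ?_⟩, fun I hI => topSum_eq_sum_min b hI, fun q hq => ?_,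
    fun q hq r hr hqr => ?_, fun F hF => ?_⟩
  · rw [hvert] at hv
    obtain ⟨t, ht⟩ := hsimple v hv
    rw [ht.encard_edges hQ, hdim]
  · obtain ⟨q, hq, hqR⟩ := Set.exists_of_ssubset hR
    obtain ⟨v, hv, hqv⟩ := exists_tight_candidate hb hq
    obtain ⟨t, ht⟩ := hsimple v hv
    exact ht.solutionSet_ne hQ hq hqv hR.1 hqR
  · obtain ⟨v, hv, hqv⟩ := exists_tight_candidate hb hq
    obtain ⟨t, ht⟩ := hsimple v hv
    exact ht.isFacet_of_tight hQ hq hqv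
  · obtain ⟨v, hv, hqv⟩ := exists_tight_candidate hb hq
    obtain ⟨t, ht⟩ := hsimple v hv
    exact ht.eq_of_tight_eq hQ hq hr hqv hqr
  · -- a functional exposing `F` attains its maximum at some candidate vertex, which is in `F`
    obtain ⟨x, hx⟩ := hF.1.1
    obtain ⟨l, hl⟩ := hF.1.2 hF.1.1
    obtain ⟨v, hv, hxv⟩ := exists_candidate_ge_of_dual hb l (hl ▸ hx).1
    obtain ⟨t, ht⟩ := hsimple v hv
    have hvF : v ∈ F := by
      rw [hl] at hx ⊢
      exact ⟨ht.holds, fun z hz => (hx.2 z hz).trans hxv⟩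
    exact ht.exists_eq_of_isFacet hQ hF hvF
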